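/- Let $(X,\mu)$ be a $\sigma$-finite measure space with $\mu\neq 0$ and without atoms (for example, a standard one), let $1<\theta<\infty$ and let $r>0$ be real. Write $\langle f,g\rangle_\mu=\int_X f\,\bar g\,\mathrm d\mu$, and for a function $f$ on $X$ let $\mathbf N_\theta(f)(x)=|f(x)|^{\theta-2}f(x)$ if $f(x)\neq0$ and $\mathbf N_\theta(f)(x)=0$ if $f(x)=0$. Let $d^{\star}_{\theta,r}$ be the largest real number $d\ge 0$ such that $$\bigg|\bigg\langle \mathbf N_\theta(f),\frac{e}{\|e\|_{L^\theta(\mu)}}\bigg\rangle_\mu\bigg|^{\frac{r}{\theta-1}}+d\,\inf_{\alpha}\|f-\alpha e\|_{L^\theta(\mu)}^{r}\le\|f\|_{L^\theta(\mu)}^{r}$$ for all complex-valued $e,f\in L^\theta(X,\mu)$ with $e\ne0$ (with $\alpha$ ranging over $\mathbb C$), and let $d^{\star,\mathbb R}_{\theta,r}$ be the largest real number $d\ge0$ such that the same inequality holds for all real-valued $e,f\in L^\theta(X,\mu)$ with $e\neq 0$ (with $\alpha$ ranging over $\mathbb R$). Then both largest constants exist, and $$d^{\star,\mathbb R}_{\theta,r}=d^{\star}_{\theta,r}.$$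 -/

import Mathlib

open MeasureTheory

/-- `μ` has no atoms: every measurable set of positive measure has a measurable subset of
strictly smaller positive measure. On a standard Borel space with a `σ`-finite measure this is
the same as saying that points are null sets. -/
def Atomless {X : Type*} [MeasurableSpace X] (μ : Measure X) : Prop :=
  ∀ s : Set X, MeasurableSet s → 0 < μ s →
    ∃ t : Set X, t ⊆ s ∧ MeasurableSet t ∧ 0 < μ t ∧ μ t < μ s

noncomputable section

/-- The sesquilinear form `⟨f, g⟩_μ = ∫ f * conj g dμ`. -/
def sesqForm {X : Type*} [MeasurableSpace X] (𝕜 : Type*) [RCLike 𝕜] (μ : Measure X)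
    (f g : X → 𝕜) : 𝕜 :=
  ∫ x, f x * (starRingEnd 𝕜) (g x) ∂μ

open scoped Classical in
/-- The nonlinear operator `N_s(h) = |h|^(s-2) h` where `h ≠ 0`, and `0` where `h = 0`. -/
def nonlinN {X : Type*} {𝕜 : Type*} [RCLike 𝕜] (s : ℝ) (h : X → 𝕜) : X → 𝕜 :=
  fun x => if h x = 0 then 0 else ((‖h x‖ ^ (s - 2) : ℝ) : 𝕜) * h x

/-- The inequality
`|⟨N_θ(f), e/‖e‖⟩|^(r/(θ-1)) + d * inf_α ‖f - α e‖^r ≤ ‖f‖^r`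
for all `𝕜`-valued `f, e ∈ L^θ(μ)` with `e ≠ 0`; the norms are those of `L^θ(μ)` and `α` ranges
over the scalars `𝕜`. -/
def ImprovedHolder {X : Type*} [MeasurableSpace X] (𝕜 : Type*) [RCLike 𝕜] (μ : Measure X)
    (θ r d : ℝ) : Prop :=
  ∀ f e : Lp 𝕜 (ENNReal.ofReal θ) μ, e ≠ 0 →
    ‖sesqForm 𝕜 μ (nonlinN θ (fun x => f x)) (fun x => e x / ((‖e‖ : ℝ) : 𝕜))‖ ^ (r / (θ - 1))
      + d * (⨅ α : 𝕜, ‖f - α • e‖ ^ r) ≤ ‖f‖ ^ r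

/-- The constants `d ≥ 0` for which the inequality holds for all `𝕜`-valued functions. -/
def admissibleConstants {X : Type*} [MeasurableSpace X] (𝕜 : Type*) [RCLike 𝕜] (μ : Measure X)
    (θ r : ℝ) : Set ℝ :=
  {d : ℝ | 0 ≤ d ∧ ImprovedHolder 𝕜 μ θ r d}

/-- The optimal constant for `𝕜`-valued functions: `𝕜 = ℂ` gives `d*_{θ,r}` and `𝕜 = ℝ` gives
`d^{*,ℝ}_{θ,r}`. -/
def dStar {X : Type*} [MeasurableSpace X] (𝕜 : Type*) [RCLike 𝕜] (μ : Measure X)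
    (θ r : ℝ) : ℝ :=
  sSup (admissibleConstants 𝕜 μ θ r)

end

/-! Both largest constants exist because the set of admissible constants is closed, contains `0` by
Hölder's inequality and is bounded by `1`. Equality follows once the real and complex sets coincide.
Real functions are complex functions, so the content is that a real constant also serves complex
functions.

Put `b = e / ‖e‖` and let `c` be the unimodular number that makes the pairing nonnegative. Under the
probability measure `|b|^θ dμ` the three quantities in the inequality become moments of `Z = c f /
b`: the mean of `N_θ(Z)`, that of `|Z|^θ`, and the infimum over `α` of the mean of `|Z - α|^θ`. It
suffices that this triple lies in the closure of the region of triples coming from finitely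
supported real laws. That region depends on neither `r` nor `d`, and on an atomless space each real
law is the law of a function on a set of finite measure, so the real inequality holds on it and,
being a closed condition, on its closure.

The region is convex. If the triple were outside the closure, Hahn–Banach would give a separating
functional, and a one-dimensional minimax argument (`exists_translation_of_lagrangian_le`) would
replace the infimum over `α` by a single real `α`, leaving a pointwise bound on the real line. The
crux is `lagrangian_le_complex`: this bound persists on the whole complex plane. Integrating it
contradicts the separation. -/

/-! ### Tangent-line and convexity estimates for powers. -/

theorem rpow_tangent_le {θ u v : ℝ} (hθ : 1 ≤ θ) (hu : 0 < u) :
    u ^ θ + θ * u ^ (θ - 1) * (v - u) ≤ |v| ^ θ := by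
  have hpos : (0 : ℝ) < u ^ θ := Real.rpow_pos_of_pos hu _
  have h1 : u ^ (θ - 1) = u ^ θ / u := by rw [Real.rpow_sub_one hu.ne']
  rcases le_total 0 v with hv | hv
  · have hb := one_add_mul_self_le_rpow_one_add (s := v / u - 1)
      (by have := div_nonneg hv hu.le; linarith) hθ
    rw [add_sub_cancel, Real.div_rpow hv hu.le, le_div_iff₀ hpos] at hb
    rw [abs_of_nonneg hv, h1]
    calc _ = (1 + θ * (v / u - 1)) * u ^ θ := by field_simp
      _ ≤ _ := hb
  · have h2 : u ^ θ + θ * u ^ (θ - 1) * (v - u) ≤ 0 := by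
      rw [h1]
      have : u ^ θ + θ * (u ^ θ / u) * (v - u) = u ^ θ * (1 - θ) + θ * (u ^ θ / u) * v := by
        field_simp; ring
      rw [this]
      have h3 : 0 ≤ θ * (u ^ θ / u) := by positivity
      nlinarith
    exact h2.trans (by positivity)

theorem rpow_le_tangent {p y y₀ : ℝ} (hp₀ : 0 ≤ p) (hp₁ : p ≤ 1) (hy : 0 ≤ y) (hy₀ : 0 < y₀) :
    y ^ p ≤ y₀ ^ p + p * y₀ ^ (p - 1) * (y - y₀) := by
  have hpos : (0 : ℝ) < y₀ ^ p := Real.rpow_pos_of_pos hy₀ _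
  have hb := rpow_one_add_le_one_add_mul_self (s := y / y₀ - 1)
    (by have := div_nonneg hy hy₀.le; linarith) hp₀ hp₁
  rw [add_sub_cancel, Real.div_rpow hy hy₀.le, div_le_iff₀ hpos] at hb
  rw [Real.rpow_sub_one hy₀.ne']
  calc _ ≤ _ := hb
    _ = _ := by field_simp

/-- In the variable `log z` both powers are exponentials, hence convex whatever the sign of the
exponent. -/
theorem rpow_combination_le_max {a b θ : ℝ} (hb : 0 ≤ b) {x y z : ℝ} (hx : 0 < x) (hxz : x ≤ z)
    (hzy : z ≤ y) (hab : 0 ≤ a) :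
    a * z ^ θ + b * z ^ (θ - 2) ≤
      max (a * x ^ θ + b * x ^ (θ - 2)) (a * y ^ θ + b * y ^ (θ - 2)) := by
  have hz := hx.trans_le hxz
  have hy := hz.trans_le hzy
  have hc : ConvexOn ℝ Set.univ
      (fun u : ℝ => a * (Real.exp θ) ^ u + b * (Real.exp (θ - 2)) ^ u) :=
    ((convexOn_rpow_left (Real.exp_pos _)).smul hab).add
      ((convexOn_rpow_left (Real.exp_pos _)).smul hb)
  have := hc.le_max_of_mem_Icc (Set.mem_univ (Real.log x)) (Set.mem_univ (Real.log y))
    (z := Real.log z) ⟨Real.log_le_log hx hxz, Real.log_le_log hz hzy⟩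
  simp only [← Real.exp_mul] at this
  simpa only [Real.rpow_def_of_pos hx, Real.rpow_def_of_pos hy, Real.rpow_def_of_pos hz,
    mul_comm (Real.log _)] using this

/-! ### The Lagrangian bound: from the real line to the complex plane. -/

section
variable {θ w l κ s α : ℝ}

/-- Growth at infinity forces `w ≤ κ`. -/
theorem le_of_lagrangian_le (hθ : 1 < θ) (hw : 0 ≤ w)
    (h : ∀ x : ℝ, w * |x - α| ^ θ + l * (|x| ^ (θ - 2) * x) - κ * |x| ^ θ ≤ s) : w ≤ κ := by
  -- Evaluate at `x = ±n` with sign opposite to `α`, so that `|x - α| ≥ n`, and divide by `n ^ θ`.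
  have hn : ∀ n : ℝ, 0 < n → (w - κ) ≤ s * n ^ (-θ) + |l| * n ^ (-(1:ℝ)) := by
    intro n hn
    have key : (w - κ) * n ^ θ ≤ s + |l| * n ^ (θ - 1) := by
      have hpow : n ^ (θ - 1) = n ^ (θ - 2) * n := by
        rw [← Real.rpow_add_one hn.ne']; congr 1; ring
      have hpp : 0 < n ^ (θ - 2) * n := by positivity
      rcases le_total 0 α with hα | hα
      · have h1 := h (-n)
        have h2 : n ^ θ ≤ |(-n) - α| ^ θ := by
          apply Real.rpow_le_rpow hn.le _ (by linarith)
          rw [abs_of_nonpos (by linarith)]; linarith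
        rw [abs_neg, abs_of_pos hn] at h1
        rw [hpow]
        nlinarith [le_abs_self l, mul_le_mul_of_nonneg_left h2 hw]
      · have h1 := h n
        have h2 : n ^ θ ≤ |n - α| ^ θ := by
          apply Real.rpow_le_rpow hn.le _ (by linarith)
          rw [abs_of_nonneg (by linarith)]; linarith
        rw [abs_of_pos hn] at h1
        rw [hpow]
        nlinarith [neg_abs_le l, mul_le_mul_of_nonneg_left h2 hw]
    have h3 := mul_le_mul_of_nonneg_right key (Real.rpow_pos_of_pos hn (-θ)).le
    rw [mul_assoc, ← Real.rpow_add hn, add_mul, mul_assoc, ← Real.rpow_add hn] at h3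
    simpa [show θ - 1 + -θ = -1 by ring] using h3
  have ht : Filter.Tendsto (fun n : ℝ => s * n ^ (-θ) + |l| * n ^ (-(1:ℝ))) Filter.atTop
      (nhds (s * 0 + |l| * 0)) :=
    ((tendsto_rpow_neg_atTop (by linarith)).const_mul s).add
      ((tendsto_rpow_neg_atTop one_pos).const_mul _)
  have := ge_of_tendsto ht (Filter.eventually_atTop.2 ⟨1, fun n hn' => hn n (by linarith)⟩)
  linarith

/-- Here `ρ` is the modulus and `c` the real part of a complex point. For `θ / 2 ≥ 1` the left side
is convex in `c` at fixed `ρ`, so it is controlled by `c = ±ρ`, the two real points of the circle.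
-/
theorem lagrangian_le_of_two_le (hθ : 2 ≤ θ) (hw : 0 ≤ w)
    (h : ∀ x : ℝ, w * |x - α| ^ θ + l * (|x| ^ (θ - 2) * x) - κ * |x| ^ θ ≤ s)
    {ρ c : ℝ} (hρ : 0 < ρ) (hc : |c| ≤ ρ) :
    w * (ρ ^ 2 + α ^ 2 - 2 * α * c) ^ (θ / 2) + l * (ρ ^ (θ - 2) * c) - κ * ρ ^ θ ≤ s := by
  obtain ⟨hc1, hc2⟩ := abs_le.1 hc
  have e1 : |ρ - α| ^ θ = ((ρ - α) ^ 2) ^ (θ / 2) := by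
    rw [← sq_abs, ← Real.rpow_natCast, ← Real.rpow_mul (abs_nonneg _)]; congr 1; push_cast; ring
  have e2 : |-ρ - α| ^ θ = ((-ρ - α) ^ 2) ^ (θ / 2) := by
    rw [← sq_abs, ← Real.rpow_natCast, ← Real.rpow_mul (abs_nonneg _)]; congr 1; push_cast; ring
  have h1 := h ρ
  have h2 := h (-ρ)
  rw [abs_neg, e2, abs_of_pos hρ] at h2
  rw [e1, abs_of_pos hρ] at h1
  set p := (ρ + c) / (2 * ρ) with hp
  set q := (ρ - c) / (2 * ρ) with hq
  have hp0 : 0 ≤ p := div_nonneg (by linarith) (by linarith)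
  have hq0 : 0 ≤ q := div_nonneg (by linarith) (by linarith)
  have hpq : p + q = 1 := by rw [hp, hq]; field_simp; ring
  have hpc : (p - q) * ρ = c := by rw [hp, hq]; field_simp; ring
  have hconv := (convexOn_rpow (p := θ / 2) (by linarith)).2 (Set.mem_Ici.2 (sq_nonneg (ρ - α)))
    (Set.mem_Ici.2 (sq_nonneg (-ρ - α))) hp0 hq0 hpq
  simp only [smul_eq_mul] at hconv
  have e3 : p * (ρ - α) ^ 2 + q * (-ρ - α) ^ 2 = ρ ^ 2 + α ^ 2 - 2 * α * c := by
    rw [← hpc]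
    linear_combination (ρ ^ 2 + α ^ 2) * hpq
  rw [e3] at hconv
  have h3 := mul_le_mul_of_nonneg_left hconv hw
  have h4 := mul_le_mul_of_nonneg_left h1 hp0
  have h5 := mul_le_mul_of_nonneg_left h2 hq0
  have h6 : p * s + q * s = s := by rw [← add_mul, hpq, one_mul]
  have h7 : l * (ρ ^ (θ - 2) * c) = p * (l * (ρ ^ (θ - 2) * ρ)) + q * (l * (ρ ^ (θ - 2) * -ρ)) := by
    rw [← hpc]; ring
  have h8 : κ * ρ ^ θ = p * (κ * ρ ^ θ) + q * (κ * ρ ^ θ) := by rw [← add_mul, hpq, one_mul]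
  linarith

/-- Now the left side is concave in `c`, and its critical point can be interior. The derivative in
`c` vanishes exactly where `|z - α| = k |z|` with `w θ α k ^ (θ - 2) = l`, an Apollonius circle. If
the circle of radius `ρ` does not cross it, the expression is monotone in `c` and a real endpoint is
maximal. Otherwise the critical value, as a function of `ρ`, is bounded by its values at the real
points of the Apollonius circle, where the hypothesis applies. -/
theorem lagrangian_le_of_lt_two (hθ : 1 < θ) (hθ2 : θ < 2) (hw : 0 < w) (hl : 0 < l)
    (hα : 0 < α)
    (h : ∀ x : ℝ, w * |x - α| ^ θ + l * (|x| ^ (θ - 2) * x) - κ * |x| ^ θ ≤ s)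
    {ρ c : ℝ} (hρ : 0 < ρ) (hc : |c| ≤ ρ) :
    w * (ρ ^ 2 + α ^ 2 - 2 * α * c) ^ (θ / 2) + l * (ρ ^ (θ - 2) * c) - κ * ρ ^ θ ≤ s := by
  obtain ⟨hc1, hc2⟩ := abs_le.1 hc
  have hy : 0 ≤ ρ ^ 2 + α ^ 2 - 2 * α * c := by nlinarith [sq_nonneg (ρ - α)]
  have sq_rpow : ∀ x p : ℝ, 0 ≤ x → (x ^ 2) ^ p = x ^ (2 * p) := fun x p hx => by
    rw [← Real.rpow_natCast, ← Real.rpow_mul hx]; norm_num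
  -- the ratio of the Apollonius circle
  obtain ⟨k, hk, hkl⟩ : ∃ k : ℝ, 0 < k ∧ w * θ * α * k ^ (θ - 2) = l := by
    refine ⟨(l / (w * θ * α)) ^ (θ - 2)⁻¹, by positivity, ?_⟩
    rw [← Real.rpow_mul (by positivity), inv_mul_cancel₀ (by linarith), Real.rpow_one]
    field_simp
  -- outside the circle the Lagrangian is monotone in `c`
  have mono1 : k * ρ ≤ |ρ - α| →
      w * (ρ ^ 2 + α ^ 2 - 2 * α * c) ^ (θ / 2) + l * (ρ ^ (θ - 2) * c) - κ * ρ ^ θ ≤ s := by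
    intro hkρ
    have hq : 0 < |ρ - α| := lt_of_lt_of_le (by positivity) hkρ
    have ht := rpow_le_tangent (p := θ / 2) (by linarith) (by linarith) hy
      (y₀ := |ρ - α| ^ 2) (by positivity)
    rw [sq_rpow _ _ hq.le, sq_rpow _ _ hq.le, sq_abs] at ht
    rw [show 2 * (θ / 2) = θ by ring, show 2 * (θ / 2 - 1) = θ - 2 by ring,
      show ρ ^ 2 + α ^ 2 - 2 * α * c - (ρ - α) ^ 2 = 2 * α * (ρ - c) by ring] at ht
    have hm : |ρ - α| ^ (θ - 2) ≤ k ^ (θ - 2) * ρ ^ (θ - 2) := by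
      rw [← Real.mul_rpow hk.le hρ.le]
      exact Real.rpow_le_rpow_of_nonpos (by positivity) hkρ (by linarith)
    have h1 := h ρ
    rw [abs_of_pos hρ] at h1
    have h2 := mul_le_mul_of_nonneg_left ht hw.le
    have h3 := mul_le_mul_of_nonneg_left hm
      (show 0 ≤ w * θ * α * (ρ - c) from mul_nonneg (by positivity) (by linarith))
    rw [← hkl] at h1 ⊢
    nlinarith
  have mono2 : ρ + α ≤ k * ρ →
      w * (ρ ^ 2 + α ^ 2 - 2 * α * c) ^ (θ / 2) + l * (ρ ^ (θ - 2) * c) - κ * ρ ^ θ ≤ s := by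
    intro hkρ
    have hq : 0 < ρ + α := by positivity
    have ht := rpow_le_tangent (p := θ / 2) (by linarith) (by linarith) hy
      (y₀ := (ρ + α) ^ 2) (by positivity)
    rw [sq_rpow _ _ hq.le, sq_rpow _ _ hq.le] at ht
    rw [show 2 * (θ / 2) = θ by ring, show 2 * (θ / 2 - 1) = θ - 2 by ring,
      show ρ ^ 2 + α ^ 2 - 2 * α * c - (ρ + α) ^ 2 = -(2 * α * (ρ + c)) by ring] at ht
    have hm : k ^ (θ - 2) * ρ ^ (θ - 2) ≤ (ρ + α) ^ (θ - 2) := by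
      rw [← Real.mul_rpow hk.le hρ.le]
      exact Real.rpow_le_rpow_of_nonpos (by positivity) hkρ (by linarith)
    have h1 := h (-ρ)
    rw [abs_neg, abs_of_pos hρ, show -ρ - α = -(ρ + α) by ring, abs_neg, abs_of_pos hq] at h1
    have h2 := mul_le_mul_of_nonneg_left ht hw.le
    have h3 := mul_le_mul_of_nonneg_left hm
      (show 0 ≤ w * θ * α * (ρ + c) from mul_nonneg (by positivity) (by linarith))
    rw [← hkl] at h1 ⊢
    nlinarith
  by_cases hA : k * ρ ≤ |ρ - α|
  · exact mono1 hA
  by_cases hB : ρ + α ≤ k * ρ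
  · exact mono2 hB
  push Not at hA hB
  obtain ⟨hA1, hA2⟩ := abs_lt.1 hA
  -- Coefficients of the tangent bound at `y₀ = (k ρ) ^ 2`; the choice of `k` cancels the terms in
  -- `c`.
  set a := w * (k ^ θ * (1 - θ / 2) + θ / 2 * k ^ (θ - 2)) - κ with ha
  set b := w * α ^ 2 * (θ / 2) * k ^ (θ - 2) with hb
  have hb0 : 0 ≤ b := by positivity
  have hsplit : ∀ x : ℝ, 0 < x → x ^ θ = x ^ (θ - 2) * x ^ 2 := fun x hx => by
    rw [← Real.rpow_natCast, ← Real.rpow_add hx]; congr 1; push_cast; ring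
  have hmain : w * (ρ ^ 2 + α ^ 2 - 2 * α * c) ^ (θ / 2) + l * (ρ ^ (θ - 2) * c) - κ * ρ ^ θ
      ≤ a * ρ ^ θ + b * ρ ^ (θ - 2) := by
    have ht := rpow_le_tangent (p := θ / 2) (by linarith) (by linarith) hy
      (y₀ := (k * ρ) ^ 2) (by positivity)
    rw [sq_rpow _ _ (by positivity), sq_rpow _ _ (by positivity), show 2 * (θ / 2) = θ by ring,
      show 2 * (θ / 2 - 1) = θ - 2 by ring, Real.mul_rpow hk.le hρ.le,
      Real.mul_rpow hk.le hρ.le] at ht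
    have h2 := mul_le_mul_of_nonneg_left ht hw.le
    rw [ha, hb, ← hkl]
    rw [hsplit ρ hρ, hsplit k hk] at h2 ⊢
    nlinarith
  -- equality on the circle
  have hcirc : ∀ x : ℝ, x ≠ 0 → |x - α| = k * |x| → a * |x| ^ θ + b * |x| ^ (θ - 2) ≤ s := by
    intro x hx0 hx
    have hx' : 0 < |x| := abs_pos.2 hx0
    have h1 := h x
    have hsq : (x - α) ^ 2 = k ^ 2 * |x| ^ 2 := by rw [← sq_abs, hx]; ring
    rw [hx, Real.mul_rpow hk.le hx'.le, ← hkl] at h1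
    refine le_trans (le_of_eq ?_) h1
    rw [ha, hb, hsplit _ hx', hsplit k hk]
    have h3 : α ^ 2 = k ^ 2 * |x| ^ 2 - |x| ^ 2 + 2 * x * α := by
      rw [← hsq, sq_abs]; ring
    linear_combination (w * (θ / 2) * k ^ (θ - 2) * |x| ^ (θ - 2)) * h3
  refine hmain.trans ?_
  set ρ₀ := α / (1 + k) with hρ₀
  have hρ₀pos : 0 < ρ₀ := by positivity
  have hρ₀k : ρ₀ * (1 + k) = α := by rw [hρ₀]; field_simp
  have hle₀ : ρ₀ ≤ ρ := by rw [hρ₀, div_le_iff₀ (by positivity)]; linarith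
  have hend₀ : a * ρ₀ ^ θ + b * ρ₀ ^ (θ - 2) ≤ s := by
    have := hcirc ρ₀ hρ₀pos.ne' (by
      rw [abs_of_pos hρ₀pos, abs_of_nonpos (by nlinarith)]; linarith)
    rwa [abs_of_pos hρ₀pos] at this
  -- For `a ≤ 0` the bound decreases in `ρ`, so the inner real point `ρ₀` suffices. For `a > 0`
  -- convexity in `log ρ` also requires the outer real point, of modulus `α / |1 - k|`.
  rcases le_or_gt a 0 with ha0 | ha0
  · refine le_trans (add_le_add ?_ ?_) hend₀
    · exact mul_le_mul_of_nonpos_left (Real.rpow_le_rpow hρ₀pos.le hle₀ (by linarith)) ha0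
    · exact mul_le_mul_of_nonneg_left
        (Real.rpow_le_rpow_of_nonpos hρ₀pos hle₀ (by linarith)) hb0
  · obtain ⟨x, hx0, hx, hρx⟩ : ∃ x : ℝ, x ≠ 0 ∧ |x - α| = k * |x| ∧ ρ ≤ |x| := by
      rcases lt_trichotomy k 1 with hk1 | hk1 | hk1
      · have h1k : 0 < 1 - k := by linarith
        have hx : 0 < α / (1 - k) := by positivity
        have e : α / (1 - k) * (1 - k) = α := by field_simp
        refine ⟨α / (1 - k), hx.ne', ?_, ?_⟩
        · rw [abs_of_pos hx, abs_of_nonneg (by nlinarith)]; linarith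
        · rw [abs_of_pos hx, le_div_iff₀ h1k]; linarith
      -- The Apollonius circle is a line without outer point, but then `a = w - κ`, which growth at
      -- infinity makes nonpositive.
      · exfalso
        have hwκ := le_of_lagrangian_le hθ hw.le h
        rw [hk1, Real.one_rpow, Real.one_rpow] at ha
        linarith
      · have h1k : 0 < k - 1 := by linarith
        have hx : 0 < α / (k - 1) := by positivity
        have e : α / (k - 1) * (k - 1) = α := by field_simp
        refine ⟨-(α / (k - 1)), by linarith, ?_, ?_⟩
        · rw [abs_neg, abs_of_pos hx, abs_of_nonpos (by linarith)]; linarith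
        · rw [abs_neg, abs_of_pos hx, le_div_iff₀ h1k]; linarith
    exact (rpow_combination_le_max hb0 hρ₀pos hle₀ hρx ha0.le).trans
      (max_le hend₀ (hcirc x hx0 hx))

/-- A Lagrangian bound on the real line extends to the complex plane. -/
theorem lagrangian_le_complex (hθ : 1 < θ) (hw : 0 ≤ w) (hl : 0 ≤ l)
    (h : ∀ x : ℝ, w * |x - α| ^ θ + l * (|x| ^ (θ - 2) * x) - κ * |x| ^ θ ≤ s) (z : ℂ) :
    w * ‖z - α‖ ^ θ + l * (‖z‖ ^ (θ - 2) * z.re) - κ * ‖z‖ ^ θ ≤ s := by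
  rcases eq_or_ne z 0 with rfl | hz
  · simpa using h 0
  have hρ : 0 < ‖z‖ := norm_pos_iff.2 hz
  have hre : |z.re| ≤ ‖z‖ := Complex.abs_re_le_norm z
  -- In the degenerate cases `α ≤ 0` or `l = 0`, one real point of the same modulus increases both
  -- varying terms at once.
  have hbase : ∀ x : ℝ, |x| = ‖z‖ → ‖z - α‖ ≤ |x - α| → l * z.re ≤ l * x →
      w * ‖z - α‖ ^ θ + l * (‖z‖ ^ (θ - 2) * z.re) - κ * ‖z‖ ^ θ ≤ s := by
    intro x hx h1 h2
    have h3 := h x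
    rw [hx] at h3
    have h4 := mul_le_mul_of_nonneg_left
      (Real.rpow_le_rpow (norm_nonneg _) h1 (by linarith : (0 : ℝ) ≤ θ)) hw
    have h5 := mul_le_mul_of_nonneg_left h2 (Real.rpow_nonneg hρ.le (θ - 2))
    linarith
  have hnorm : ‖z - α‖ ≤ ‖z‖ + |α| := by
    simpa using norm_sub_le z (α : ℂ)
  have hle := (abs_le.1 hre).2
  rcases le_or_gt α 0 with hα | hα
  · refine hbase ‖z‖ (abs_of_pos hρ) ?_ (mul_le_mul_of_nonneg_left hle hl)
    rw [abs_of_nonneg (by linarith)]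
    rwa [abs_of_nonpos hα, ← sub_eq_add_neg] at hnorm
  rcases hl.eq_or_lt with rfl | hl'
  · refine hbase (-‖z‖) (by simp) ?_ (by simp)
    rw [abs_of_nonpos (by linarith)]
    rw [abs_of_pos hα] at hnorm
    linarith
  rcases hw.eq_or_lt with rfl | hw'
  · have h3 := h ‖z‖
    rw [abs_of_pos hρ] at h3
    have h5 := mul_le_mul_of_nonneg_left (mul_le_mul_of_nonneg_left hle hl)
      (Real.rpow_nonneg hρ.le (θ - 2))
    linarith
  have hq : ‖z - α‖ ^ θ = (‖z‖ ^ 2 + α ^ 2 - 2 * α * z.re) ^ (θ / 2) := by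
    have : ‖z‖ ^ 2 + α ^ 2 - 2 * α * z.re = ‖z - α‖ ^ 2 := by
      rw [Complex.sq_norm, Complex.sq_norm, Complex.normSq_apply, Complex.normSq_apply]
      simp; ring
    rw [this, ← Real.rpow_natCast, ← Real.rpow_mul (norm_nonneg _)]
    congr 1; push_cast; ring
  rw [hq]
  rcases le_or_gt 2 θ with h2 | h2
  · exact lagrangian_le_of_two_le h2 hw h hρ hre
  · exact lagrangian_le_of_lt_two hθ h2 hw' hl' hα h hρ hre

end

/-! ### Real laws, separation and minimax. -/

/-- Finitely supported probability laws on the real line. -/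
def IsFiniteLaw (ν : ℝ →₀ ℝ) : Prop :=
  (∀ x, 0 ≤ ν x) ∧ Finsupp.linearCombination ℝ (fun _ : ℝ => (1 : ℝ)) ν = 1

/-- The triples `(A, B, m)` for which some finitely supported law has `A ≤ E N_θ`,
`E |x|^θ ≤ B` and `m ≤ E |x - α|^θ` for all `α`. -/
def lawRegion (θ : ℝ) : Set (ℝ × ℝ × ℝ) :=
  {p | ∃ ν : ℝ →₀ ℝ, IsFiniteLaw ν ∧
    p.1 ≤ Finsupp.linearCombination ℝ (fun x : ℝ => |x| ^ (θ - 2) * x) ν ∧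
    Finsupp.linearCombination ℝ (fun x : ℝ => |x| ^ θ) ν ≤ p.2.1 ∧
    ∀ α : ℝ, p.2.2 ≤ Finsupp.linearCombination ℝ (fun x : ℝ => |x - α| ^ θ) ν}

theorem isFiniteLaw_single (x : ℝ) : IsFiniteLaw (Finsupp.single x 1) := by
  refine ⟨fun y => ?_, by simp⟩
  rw [Finsupp.single_apply]; split_ifs <;> norm_num

theorem IsFiniteLaw.convex_combination {ν ν' : ℝ →₀ ℝ} (h : IsFiniteLaw ν) (h' : IsFiniteLaw ν')
    {a b : ℝ} (ha : 0 ≤ a) (hb : 0 ≤ b) (hab : a + b = 1) : IsFiniteLaw (a • ν + b • ν') := by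
  refine ⟨fun x => ?_, ?_⟩
  · simpa using add_nonneg (mul_nonneg ha (h.1 x)) (mul_nonneg hb (h'.1 x))
  · rw [map_add, map_smul, map_smul, h.2, h'.2]; simpa using hab

/-- All moments are linear in the law, and requiring the bound on `m` for every `α` encodes a
concave infimum. -/
theorem convex_lawRegion (θ : ℝ) : Convex ℝ (lawRegion θ) := by
  rintro p ⟨ν, hν, h1, h2, h3⟩ q ⟨ν', hν', h1', h2', h3'⟩ a b ha hb hab
  refine ⟨a • ν + b • ν', hν.convex_combination hν' ha hb hab, ?_, ?_, fun α => ?_⟩ <;>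
    simp only [map_add, map_smul, smul_eq_mul, Prod.fst_add, Prod.smul_fst, Prod.snd_add,
      Prod.smul_snd]
  · gcongr
  · gcongr
  · have := h3 α
    have := h3' α
    gcongr

theorem exists_lagrangian_of_notMem_closure {θ : ℝ} (hθ : 0 < θ) {A B m : ℝ}
    (hp : (A, B, m) ∉ closure (lawRegion θ)) :
    ∃ l κ w s : ℝ, 0 ≤ l ∧ 0 ≤ w ∧
      (∀ q ∈ lawRegion θ, l * q.1 - κ * q.2.1 + w * q.2.2 ≤ s) ∧ s < l * A - κ * B + w * m := by
  obtain ⟨f, s, hf, hs⟩ := geometric_hahn_banach_closed_point (convex_lawRegion θ).closure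
    isClosed_closure hp
  have hlin : ∀ x y z : ℝ, f (x, y, z) = f (1, 0, 0) * x + f (0, 1, 0) * y + f (0, 0, 1) * z := by
    intro x y z
    have : ((x, y, z) : ℝ × ℝ × ℝ)
        = x • ((1, 0, 0) : ℝ × ℝ × ℝ) + y • ((0, 1, 0) : ℝ × ℝ × ℝ)
          + z • ((0, 0, 1) : ℝ × ℝ × ℝ) := by simp
    rw [this, map_add, map_add, map_smul, map_smul, map_smul]
    simp only [smul_eq_mul]; ring
  -- The inequalities in `lawRegion` let the first and third coordinates go to `-∞`, which forces
  -- the signs of `l` and `w`.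
  have hmem : ∀ x z : ℝ, x ≤ 0 → z ≤ 0 → (x, 0, z) ∈ lawRegion θ := by
    intro x z hx hz
    refine ⟨Finsupp.single 0 1, isFiniteLaw_single 0, by simpa using hx,
      by simp [Real.zero_rpow hθ.ne'], fun α => hz.trans ?_⟩
    simp; positivity
  have hbd : ∀ q ∈ lawRegion θ, f q < s := fun q hq => hf q (subset_closure hq)
  have hsign : ∀ c : ℝ, (∀ t : ℝ, 0 ≤ t → c * t < s) → c ≤ 0 := by
    intro c hc
    by_contra! hc'
    have h0 := hc 0 le_rfl
    have := hc (s / c) (div_nonneg (by linarith) hc'.le)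
    rw [mul_div_cancel₀ _ hc'.ne'] at this
    exact lt_irrefl _ this
  refine ⟨f (1, 0, 0), -f (0, 1, 0), f (0, 0, 1), s, ?_, ?_, ?_, ?_⟩
  · rw [← neg_nonpos]
    refine hsign _ fun t ht => ?_
    have := hbd _ (hmem (-t) 0 (by linarith) le_rfl)
    rw [hlin] at this; linarith
  · rw [← neg_nonpos]
    refine hsign _ fun t ht => ?_
    have := hbd _ (hmem 0 (-t) le_rfl (by linarith))
    rw [hlin] at this; linarith
  · rintro ⟨x, y, z⟩ hq
    have := hbd _ hq
    rw [hlin] at this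
    simp only; linarith
  · rw [hlin] at hs; linarith

/-- A one-dimensional minimax principle: the translation parameter can be chosen uniformly. -/
theorem exists_translation_of_lagrangian_le {θ l κ w s : ℝ} (hθ : 1 < θ) (hw : 0 ≤ w)
    (h : ∀ q ∈ lawRegion θ, l * q.1 - κ * q.2.1 + w * q.2.2 ≤ s) :
    ∃ α : ℝ, ∀ x : ℝ, w * |x - α| ^ θ + l * (|x| ^ (θ - 2) * x) - κ * |x| ^ θ ≤ s := by
  have hθ0 : 0 < θ := by linarith
  have hdirac : ∀ x : ℝ, l * (|x| ^ (θ - 2) * x) - κ * |x| ^ θ ≤ s := by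
    intro x
    have := h (|x| ^ (θ - 2) * x, |x| ^ θ, 0)
      ⟨Finsupp.single x 1, isFiniteLaw_single x, by simp, by simp, fun α => by
        simp; positivity⟩
    simpa using this
  rcases hw.eq_or_lt with rfl | hw'
  · exact ⟨0, fun x => by simpa using hdirac x⟩
  -- The bound at `x` says `|x - α| ^ θ ≤ D x`, that is, `α` lies in the interval of center `x` and
  -- radius `R x`. By Helly in dimension one, pairwise intersection suffices.
  set D : ℝ → ℝ := fun x => (s - l * (|x| ^ (θ - 2) * x) + κ * |x| ^ θ) / w with hD
  have hD0 : ∀ x, 0 ≤ D x := fun x => div_nonneg (by linarith [hdirac x]) hw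
  have hwD : ∀ x, w * D x = s - l * (|x| ^ (θ - 2) * x) + κ * |x| ^ θ := fun x => by
    rw [hD]; field_simp
  set R : ℝ → ℝ := fun x => D x ^ θ⁻¹ with hR
  have hR0 : ∀ x, 0 ≤ R x := fun x => Real.rpow_nonneg (hD0 x) _
  have hRD : ∀ x, R x ^ θ = D x := fun x => Real.rpow_inv_rpow (hD0 x) hθ0.ne'
  have hpair : ∀ x y, x - R x ≤ y + R y := by
    intro x y
    by_contra! hxy
    set δ := (x - y - R x - R y) / 2 with hδ
    have hδ0 : 0 < δ := by rw [hδ]; linarith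
    set u := R y + δ with hu
    set v := R x + δ with hv
    have hu0 : 0 < u := by linarith [hR0 y]
    have hv0 : 0 < v := by linarith [hR0 x]
    have huv : u + v = x - y := by rw [hu, hv, hδ]; ring
    have hU : 0 < u ^ (θ - 1) := Real.rpow_pos_of_pos hu0 _
    have hV : 0 < v ^ (θ - 1) := Real.rpow_pos_of_pos hv0 _
    -- Two disjoint intervals are refuted by a two-point law. These weights balance the derivatives
    -- at `α = y + u = x - v`, making it the minimizer of the mean of `|· - α| ^ θ`.
    set p := v ^ (θ - 1) / (u ^ (θ - 1) + v ^ (θ - 1)) with hp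
    set q := u ^ (θ - 1) / (u ^ (θ - 1) + v ^ (θ - 1)) with hq
    have hp0 : 0 < p := by positivity
    have hq0 : 0 < q := by positivity
    have hpq : p + q = 1 := by rw [hp, hq]; field_simp; ring
    have hbal : p * u ^ (θ - 1) = q * v ^ (θ - 1) := by rw [hp, hq]; ring
    have hval := h (p * (|y| ^ (θ - 2) * y) + q * (|x| ^ (θ - 2) * x), p * |y| ^ θ + q * |x| ^ θ,
      p * u ^ θ + q * v ^ θ)
      ⟨p • Finsupp.single y 1 + q • Finsupp.single x 1,
        (isFiniteLaw_single y).convex_combination (isFiniteLaw_single x) hp0.le hq0.le hpq,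
        by simp, by simp, fun α => by
          have h1 := mul_le_mul_of_nonneg_left
            (rpow_tangent_le (v := α - y) hθ.le hu0) hp0.le
          have h2 := mul_le_mul_of_nonneg_left
            (rpow_tangent_le (v := x - α) hθ.le hv0) hq0.le
          rw [abs_sub_comm] at h1
          simp only [map_add, map_smul, Finsupp.linearCombination_single, smul_eq_mul, one_mul]
          have h3 : x - α - v = -(α - y - u) := by linarith
          rw [h3] at h2
          have h4 : p * (θ * u ^ (θ - 1) * (α - y - u)) +
              q * (θ * v ^ (θ - 1) * -(α - y - u)) = 0 := by
            linear_combination (θ * (α - y - u)) * hbal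
          linarith⟩
    have hlt1 : D y < u ^ θ := by
      rw [← hRD]; exact Real.rpow_lt_rpow (hR0 y) (by linarith) hθ0
    have hlt2 : D x < v ^ θ := by
      rw [← hRD]; exact Real.rpow_lt_rpow (hR0 x) (by linarith) hθ0
    have h5 := mul_lt_mul_of_pos_left (mul_lt_mul_of_pos_left hlt1 hp0) hw'
    have h6 := mul_lt_mul_of_pos_left (mul_lt_mul_of_pos_left hlt2 hq0) hw'
    rw [mul_left_comm, hwD] at h5 h6
    simp only at hval
    have h7 : p * s + q * s = s := by rw [← add_mul, hpq, one_mul]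
    linarith
  have hbdd : BddAbove (Set.range fun x => x - R x) :=
    ⟨0 + R 0, by rintro _ ⟨x, rfl⟩; exact hpair x 0⟩
  refine ⟨⨆ x, (x - R x), fun x => ?_⟩
  have h1 : x - R x ≤ ⨆ x, (x - R x) := le_ciSup hbdd x
  have h2 : ⨆ x, (x - R x) ≤ x + R x := ciSup_le fun y => hpair y x
  have h3 : |x - ⨆ x, (x - R x)| ^ θ ≤ D x := by
    rw [← hRD]
    exact Real.rpow_le_rpow (abs_nonneg _) (abs_le.2 ⟨by linarith, by linarith⟩) hθ0.le
  have := mul_le_mul_of_nonneg_left h3 hw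
  rw [hwD] at this
  linarith

/-- A triple lies in the closed region of real laws as soon as it satisfies every Lagrangian
bound valid on the complex plane. -/
theorem mem_closure_lawRegion {θ A B m : ℝ} (hθ : 1 < θ)
    (h : ∀ l κ w α s : ℝ, 0 ≤ l → 0 ≤ w → w ≤ κ →
      (∀ z : ℂ, w * ‖z - α‖ ^ θ + l * (‖z‖ ^ (θ - 2) * z.re) - κ * ‖z‖ ^ θ ≤ s) →
      l * A - κ * B + w * m ≤ s) :
    (A, B, m) ∈ closure (lawRegion θ) := by
  by_contra hp
  obtain ⟨l, κ, w, s, hl, hw, hbd, hlt⟩ :=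
    exists_lagrangian_of_notMem_closure (by linarith) hp
  obtain ⟨α, hα⟩ := exists_translation_of_lagrangian_le hθ hw hbd
  exact hlt.not_ge (h l κ w α s hl hw (le_of_lagrangian_le hθ hw hα)
    (lagrangian_le_complex hθ hw hl hα))

open scoped ENNReal

/-! ### Atomless measures and realization of finite laws. -/

section
variable {X : Type*} [MeasurableSpace X] {μ : Measure X}

theorem Atomless.exists_subset_measure_le (hatom : Atomless μ) {s : Set X} (hs : MeasurableSet s)
    (hpos : 0 < μ s) (hfin : μ s ≠ ∞) {ε : ℝ≥0∞} (hε : 0 < ε) :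
    ∃ t ⊆ s, MeasurableSet t ∧ 0 < μ t ∧ μ t ≤ ε := by
  have half : ∀ u ⊆ s, MeasurableSet u → 0 < μ u →
      ∃ t ⊆ u, MeasurableSet t ∧ 0 < μ t ∧ μ t ≤ μ u / 2 := by
    intro u hus hu hu0
    obtain ⟨t, htu, ht, ht0, htlt⟩ := hatom u hu hu0
    have hufin : μ u ≠ ∞ := measure_ne_top_of_subset hus hfin
    have hadd : μ t + μ (u \ t) = μ u := by
      rw [← measure_inter_add_sdiff u ht, Set.inter_eq_self_of_subset_right htu]
    by_cases hle : μ t ≤ μ u / 2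
    · exact ⟨t, htu, ht, ht0, hle⟩
    · refine ⟨u \ t, Set.sdiff_subset, hu.diff ht, ?_, ?_⟩
      · rw [pos_iff_ne_zero]
        intro h0
        rw [h0, add_zero] at hadd
        exact htlt.ne hadd
      · by_contra! hgt
        have := ENNReal.add_lt_add (not_le.1 hle) hgt
        rw [ENNReal.add_halves, hadd] at this
        exact lt_irrefl _ this
  have iter : ∀ n : ℕ, ∃ t ⊆ s, MeasurableSet t ∧ 0 < μ t ∧ μ t ≤ μ s * 2⁻¹ ^ n := by
    intro n
    induction n with
    | zero => exact ⟨s, subset_rfl, hs, hpos, by simp⟩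
    | succ n ih =>
      obtain ⟨u, hus, hu, hu0, hule⟩ := ih
      obtain ⟨t, htu, ht, ht0, htle⟩ := half u hus hu hu0
      refine ⟨t, htu.trans hus, ht, ht0, htle.trans ?_⟩
      rw [pow_succ, ← mul_assoc, ENNReal.div_eq_inv_mul, mul_comm]
      gcongr
  have hlim : Filter.Tendsto (fun n : ℕ => μ s * (2⁻¹ : ℝ≥0∞) ^ n) Filter.atTop (nhds 0) := by
    have := ENNReal.Tendsto.const_mul (a := μ s)
      (ENNReal.tendsto_pow_atTop_nhds_zero_of_lt_one (r := 2⁻¹) (by simp)) (Or.inr hfin)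
    simpa using this
  obtain ⟨n, hn⟩ := ((tendsto_order.1 hlim).2 ε hε).exists
  obtain ⟨t, hts, ht, ht0, htle⟩ := iter n
  exact ⟨t, hts, ht, ht0, htle.trans hn.le⟩

/-- Sierpiński: an atomless measure takes every intermediate value on the subsets of a set of
finite measure. -/
theorem Atomless.exists_subset_measure_eq (hatom : Atomless μ) {s : Set X} (hs : MeasurableSet s)
    (hfin : μ s ≠ ∞) {c : ℝ≥0∞} (hc : c ≤ μ s) :
    ∃ t ⊆ s, MeasurableSet t ∧ μ t = c := by
  have hcfin : c ≠ ∞ := ne_top_of_le_ne_top hfin hc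
  let State := {u : Set X // u ⊆ s ∧ MeasurableSet u ∧ μ u ≤ c}
  -- Greedy exhaustion: each step adds at least half the measure of any piece that still fits.
  have step : ∀ u : State, ∃ u' : State, u.1 ⊆ u'.1 ∧
      ∀ w ⊆ s \ u.1, MeasurableSet w → μ u.1 + μ w ≤ c → μ u.1 + μ w / 2 ≤ μ u'.1 := by
    rintro ⟨u, hus, hu, huc⟩
    set V : Set ℝ≥0∞ := {a | ∃ v ⊆ s \ u, MeasurableSet v ∧ μ u + μ v ≤ c ∧ μ v = a} with hV
    have hVle : ∀ a ∈ V, a ≤ μ s := by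
      rintro _ ⟨v, hv, -, -, rfl⟩
      exact measure_mono (hv.trans Set.sdiff_subset)
    have hsup : sSup V ≠ ∞ := ne_top_of_le_ne_top hfin (sSup_le hVle)
    obtain ⟨v, hvs, hv, hvc, hvS⟩ : ∃ v ⊆ s \ u, MeasurableSet v ∧ μ u + μ v ≤ c ∧
        sSup V / 2 ≤ μ v := by
      rcases eq_or_ne (sSup V) 0 with h0 | h0
      · exact ⟨∅, Set.empty_subset _, .empty, by simpa using huc, by simp [h0]⟩
      · obtain ⟨_, ⟨v, hvs, hv, hvc, rfl⟩, hlt⟩ := lt_sSup_iff.1 (ENNReal.half_lt_self h0 hsup)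
        exact ⟨v, hvs, hv, hvc, hlt.le⟩
    have hdisj : Disjoint u v := (Set.disjoint_sdiff_right).mono_right hvs
    have hm : μ (u ∪ v) = μ u + μ v := measure_union hdisj hv
    refine ⟨⟨u ∪ v, Set.union_subset hus (hvs.trans Set.sdiff_subset), hu.union hv, hm ▸ hvc⟩,
      Set.subset_union_left, fun w hws hw hwc => ?_⟩
    have : μ w ≤ sSup V := le_sSup ⟨w, hws, hw, hwc, rfl⟩
    rw [hm]
    gcongr
    exact (ENNReal.div_le_div_right this 2).trans hvS
  choose next hnext hgrow using step
  let u : ℕ → State := fun n => next^[n] ⟨∅, Set.empty_subset _, .empty, by simp⟩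
  have hu : ∀ n, u (n + 1) = next (u n) := fun n => Function.iterate_succ_apply' _ _ _
  have hmono : Monotone fun n => (u n).1 :=
    monotone_nat_of_le_succ fun n => by rw [hu]; exact hnext _
  set U := ⋃ n, (u n).1 with hU
  have hUs : U ⊆ s := Set.iUnion_subset fun n => (u n).2.1
  have hUm : MeasurableSet U := .iUnion fun n => (u n).2.2.1
  have hUc : μ U ≤ c := by
    rw [hU, hmono.measure_iUnion]
    exact iSup_le fun n => (u n).2.2.2
  refine ⟨U, hUs, hUm, hUc.antisymm (le_of_not_gt fun hlt => ?_)⟩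
  have hrest : 0 < μ (s \ U) := by
    rw [measure_sdiff hUs hUm.nullMeasurableSet (ne_top_of_le_ne_top hcfin hUc)]
    exact tsub_pos_of_lt (hlt.trans_le hc)
  obtain ⟨w, hws, hw, hw0, hwle⟩ := hatom.exists_subset_measure_le (hs.diff hUm) hrest
    (measure_ne_top_of_subset Set.sdiff_subset hfin) (tsub_pos_of_lt hlt)
  -- The piece `w` fits at every stage, so each step gains at least `μ w / 2`, which eventually
  -- exceeds `c`.
  have hbound : ∀ n : ℕ, n * (μ w / 2) ≤ μ (u n).1 := by
    intro n
    induction n with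
    | zero => simp
    | succ n ih =>
      have hun : (u n).1 ⊆ U := Set.subset_iUnion (fun n => (u n).1) n
      have := hgrow (u n) w (hws.trans (Set.sdiff_subset_sdiff_right hun)) hw <| by
        calc _ ≤ μ U + (c - μ U) := add_le_add (measure_mono hun) hwle
          _ = c := add_tsub_cancel_of_le hUc
      rw [hu]
      refine le_trans ?_ this
      push_cast
      rw [add_mul, one_mul]
      gcongr
  obtain ⟨n, hn⟩ := ENNReal.exists_nat_mul_gt (a := μ w / 2) (b := c)
    (ENNReal.half_pos hw0.ne').ne' hcfin
  exact absurd ((hbound n).trans (u n).2.2.2) (not_le.2 hn)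

/-- On an atomless space every finitely supported measure on `ℝ` is the image of the restriction
to a set of the right mass. -/
theorem Atomless.exists_map_restrict_eq (hatom : Atomless μ) (S : Finset ℝ) (p : ℝ → ℝ≥0∞)
    {s : Set X} (hs : MeasurableSet s) (hfin : μ s ≠ ∞) (hsum : μ s = ∑ x ∈ S, p x) :
    ∃ G : X → ℝ, Measurable G ∧
      (μ.restrict s).map G = ∑ x ∈ S, p x • Measure.dirac x := by
  induction S using Finset.induction_on generalizing s with
  | empty =>
    refine ⟨0, measurable_zero, ?_⟩
    rw [Measure.restrict_eq_zero.2 (by simpa using hsum)]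
    simp
  | insert a S ha ih =>
    rw [Finset.sum_insert ha] at hsum
    obtain ⟨t, hts, ht, htp⟩ := hatom.exists_subset_measure_eq hs hfin
      (c := p a) (hsum ▸ le_self_add)
    have htfin : μ t ≠ ∞ := measure_ne_top_of_subset hts hfin
    obtain ⟨G, hG, hmap⟩ := ih (hs.diff ht) (measure_ne_top_of_subset Set.sdiff_subset hfin) (by
      rw [measure_sdiff hts ht.nullMeasurableSet htfin, hsum, htp,
        ENNReal.add_sub_cancel_left (htp ▸ htfin)])
    classical
    have hG' : Measurable (t.piecewise (fun _ => a) G) := measurable_const.piecewise ht hG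
    refine ⟨t.piecewise (fun _ => a) G, hG', ?_⟩
    have hsplit : μ.restrict s = μ.restrict t + μ.restrict (s \ t) := by
      rw [← Measure.restrict_union Set.disjoint_sdiff_right (hs.diff ht),
        Set.union_sdiff_cancel hts]
    rw [hsplit, Measure.map_add _ _ hG', Finset.sum_insert ha, ← hmap, ← htp]
    congr 1
    · rw [Measure.map_congr (g := fun _ => a), Measure.map_const]
      · simp
      · filter_upwards [ae_restrict_mem ht] with x hx
        simp [hx]
    · refine Measure.map_congr ?_
      filter_upwards [ae_restrict_mem (hs.diff ht)] with x hx
      simp [hx.2]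

theorem Atomless.exists_realization (hatom : Atomless μ) {s : Set X} (hs : MeasurableSet s)
    (hfin : μ s ≠ ∞) {ν : ℝ →₀ ℝ} (hν : IsFiniteLaw ν) :
    ∃ G : X → ℝ, Measurable G ∧ ∀ h : ℝ → ℝ, Measurable h →
      IntegrableOn (fun x => h (G x)) s μ ∧
      ∫ x in s, h (G x) ∂μ = μ.real s * Finsupp.linearCombination ℝ h ν := by
  have hsum1 : ∑ x ∈ ν.support, ν x = 1 := by
    simpa [Finsupp.linearCombination_apply, Finsupp.sum] using hν.2
  obtain ⟨G, hG, hmap⟩ := hatom.exists_map_restrict_eq ν.support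
    (fun x => ENNReal.ofReal (ν x) * μ s) hs hfin (by
      rw [← Finset.sum_mul, ← ENNReal.ofReal_sum_of_nonneg (fun x _ => hν.1 x), hsum1]
      simp)
  have hw : ∀ x, ENNReal.ofReal (ν x) * μ s ≠ ∞ := fun x =>
    ENNReal.mul_ne_top ENNReal.ofReal_ne_top hfin
  refine ⟨G, hG, fun h hh => ?_⟩
  have hint : ∀ x ∈ ν.support,
      Integrable h ((ENNReal.ofReal (ν x) * μ s) • Measure.dirac x) := fun x _ =>
    (integrable_dirac' hh.stronglyMeasurable (by simp)).smul_measure (hw x)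
  constructor
  · rw [IntegrableOn, ← Function.comp_def, ← integrable_map_measure hh.aestronglyMeasurable
      hG.aemeasurable, hmap]
    exact integrable_finsetSum_measure.2 hint
  · rw [← integral_map hG.aemeasurable hh.aestronglyMeasurable, hmap,
      integral_finsetSum_measure hint, Finsupp.linearCombination_apply, Finsupp.sum,
      Finset.mul_sum]
    refine Finset.sum_congr rfl fun x _ => ?_
    rw [integral_smul_measure, integral_dirac' _ _ hh.stronglyMeasurable, ENNReal.toReal_mul,
      ENNReal.toReal_ofReal (hν.1 x), measureReal_def]
    simp only [smul_eq_mul]; ring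

end

/-! ### The nonlinear operator and Hölder's inequality. -/

section
variable {X : Type*} [MeasurableSpace X] {μ : Measure X} {𝕜 : Type*} [RCLike 𝕜] {θ : ℝ}

theorem nonlinN_apply {X 𝕜 : Type*} [RCLike 𝕜] (s : ℝ) (h : X → 𝕜) (x : X) :
    nonlinN s h x = ((‖h x‖ ^ (s - 2) : ℝ) : 𝕜) * h x := by
  unfold nonlinN
  split_ifs with h0 <;> simp [h0]

theorem norm_nonlinN {X 𝕜 : Type*} [RCLike 𝕜] {θ : ℝ} (hθ : 1 < θ) (h : X → 𝕜) (x : X) :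
    ‖nonlinN θ h x‖ = ‖h x‖ ^ (θ - 1) := by
  rw [nonlinN_apply, norm_mul, RCLike.norm_ofReal, abs_of_nonneg (by positivity)]
  rcases eq_or_ne (h x) 0 with h0 | h0
  · simp [h0, Real.zero_rpow (show θ - 1 ≠ 0 by linarith)]
  · rw [← Real.rpow_add_one (by simpa using h0)]; congr 1; ring

theorem aestronglyMeasurable_nonlinN (s : ℝ) {h : X → 𝕜} (hh : AEStronglyMeasurable h μ) :
    AEStronglyMeasurable (nonlinN s h) μ := by
  have : nonlinN s h = fun x => ((‖h x‖ ^ (s - 2) : ℝ) : 𝕜) * h x := funext (nonlinN_apply s h)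
  rw [this]
  have hn : AEStronglyMeasurable (fun x => ‖h x‖ ^ (s - 2)) μ :=
    (hh.norm.aemeasurable.pow_const _).aestronglyMeasurable
  exact (RCLike.continuous_ofReal.comp_aestronglyMeasurable hn).mul hh

theorem ofReal_ne_zero_of_one_lt (hθ : 1 < θ) : ENNReal.ofReal θ ≠ 0 := by
  rw [Ne, ENNReal.ofReal_eq_zero]; linarith

theorem MeasureTheory.MemLp.integrable_norm_rpow_ofReal (hθ : 1 < θ) {f : X → 𝕜}
    (hf : MemLp f (ENNReal.ofReal θ) μ) : Integrable (fun x => ‖f x‖ ^ θ) μ := by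
  have := hf.integrable_norm_rpow (ofReal_ne_zero_of_one_lt hθ) ENNReal.ofReal_ne_top
  rwa [ENNReal.toReal_ofReal (by linarith)] at this

theorem Lp_norm_rpow (hθ : 1 < θ) (f : Lp 𝕜 (ENNReal.ofReal θ) μ) :
    ‖f‖ ^ θ = ∫ x, ‖f x‖ ^ θ ∂μ := by
  have hθ0 : 0 ≤ θ := by linarith
  have hI : 0 ≤ ∫ x, ‖f x‖ ^ θ ∂μ := integral_nonneg fun x => by positivity
  rw [Lp.norm_def, (Lp.memLp f).eLpNorm_eq_integral_rpow_norm (ofReal_ne_zero_of_one_lt hθ)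
    ENNReal.ofReal_ne_top, ENNReal.toReal_ofReal hθ0, ENNReal.toReal_ofReal (by positivity),
    Real.rpow_inv_rpow hI (by linarith)]

theorem norm_nonlinN_mul_le {X 𝕜 : Type*} [RCLike 𝕜] {θ : ℝ} (hθ : 1 < θ) (f e : X → 𝕜) (x : X) :
    ‖nonlinN θ f x * (starRingEnd 𝕜) (e x)‖ ≤ ‖f x‖ ^ θ + ‖e x‖ ^ θ := by
  rw [norm_mul, norm_nonlinN hθ, RCLike.norm_conj]
  have hsplit : ∀ a : ℝ, 0 ≤ a → a ^ (θ - 1) * a = a ^ θ := fun a ha => by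
    rw [← Real.rpow_add_one' ha (by linarith)]; congr 1; ring
  have hf := norm_nonneg (f x)
  have he := norm_nonneg (e x)
  have h1 : 0 ≤ ‖f x‖ ^ θ := by positivity
  have h2 : 0 ≤ ‖e x‖ ^ θ := by positivity
  rcases le_total ‖f x‖ ‖e x‖ with h | h
  · have := mul_le_mul_of_nonneg_right
      (Real.rpow_le_rpow hf h (show 0 ≤ θ - 1 by linarith)) he
    rw [hsplit _ he] at this; linarith
  · have := mul_le_mul_of_nonneg_left h (show 0 ≤ ‖f x‖ ^ (θ - 1) by positivity)
    rw [hsplit _ hf] at this; linarith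

theorem integrable_nonlinN_mul (hθ : 1 < θ) {f e : X → 𝕜}
    (hf : MemLp f (ENNReal.ofReal θ) μ) (he : MemLp e (ENNReal.ofReal θ) μ) :
    Integrable (fun x => nonlinN θ f x * (starRingEnd 𝕜) (e x)) μ := by
  refine ((hf.integrable_norm_rpow_ofReal hθ).add (he.integrable_norm_rpow_ofReal hθ)).mono'
    ((aestronglyMeasurable_nonlinN θ hf.1).mul
      (RCLike.continuous_conj.comp_aestronglyMeasurable he.1))
    (Filter.Eventually.of_forall (norm_nonlinN_mul_le hθ f e))

theorem memLp_div_norm (e : Lp 𝕜 (ENNReal.ofReal θ) μ) :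
    MemLp (fun x => e x / ((‖e‖ : ℝ) : 𝕜)) (ENNReal.ofReal θ) μ := by
  simpa [div_eq_mul_inv] using (Lp.memLp e).mul_const (((‖e‖ : ℝ) : 𝕜)⁻¹)

theorem integral_div_norm_rpow (hθ : 1 < θ) [Fact (1 ≤ ENNReal.ofReal θ)]
    {e : Lp 𝕜 (ENNReal.ofReal θ) μ} (he : e ≠ 0) :
    ∫ x, ‖e x / ((‖e‖ : ℝ) : 𝕜)‖ ^ θ ∂μ = 1 := by
  have hpos : 0 < ‖e‖ := norm_pos_iff.2 he
  have : ∀ x, ‖e x / ((‖e‖ : ℝ) : 𝕜)‖ ^ θ = ‖e x‖ ^ θ / ‖e‖ ^ θ := fun x => by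
    rw [norm_div, RCLike.norm_ofReal, abs_norm, Real.div_rpow (norm_nonneg _) hpos.le]
  simp_rw [this]
  rw [integral_div, ← Lp_norm_rpow hθ]
  exact div_self (Real.rpow_pos_of_pos hpos _).ne'

theorem norm_sesqForm_le (hθ : 1 < θ) [Fact (1 ≤ ENNReal.ofReal θ)]
    (f : Lp 𝕜 (ENNReal.ofReal θ) μ) {e : Lp 𝕜 (ENNReal.ofReal θ) μ} (he : e ≠ 0) :
    ‖sesqForm 𝕜 μ (nonlinN θ (fun x => f x)) (fun x => e x / ((‖e‖ : ℝ) : 𝕜))‖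
      ≤ ‖f‖ ^ (θ - 1) := by
  have hθ0 : 0 < θ := by linarith
  set b : X → 𝕜 := fun x => e x / ((‖e‖ : ℝ) : 𝕜) with hb
  have hbi : Integrable (fun x => ‖b x‖ ^ θ) μ :=
    (memLp_div_norm e).integrable_norm_rpow_ofReal hθ
  have hfi : Integrable (fun x => ‖f x‖ ^ θ) μ := (Lp.memLp f).integrable_norm_rpow_ofReal hθ
  have hb1 : ∫ x, ‖b x‖ ^ θ ∂μ = 1 := integral_div_norm_rpow hθ he
  rcases eq_or_ne f 0 with rfl | hf
  · have : sesqForm 𝕜 μ (nonlinN θ (fun x => (0 : Lp 𝕜 (ENNReal.ofReal θ) μ) x)) b = 0 := by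
      refine integral_eq_zero_of_ae ?_
      filter_upwards [Lp.coeFn_zero 𝕜 (ENNReal.ofReal θ) μ] with x hx
      rw [nonlinN_apply, hx]; simp
    rw [this, norm_zero]; positivity
  have hF : 0 < ‖f‖ := norm_pos_iff.2 hf
  have hFp : 0 < ‖f‖ ^ (θ - 1) := Real.rpow_pos_of_pos hF _
  have hFθ : ‖f‖ ^ θ = ‖f‖ ^ (θ - 1) * ‖f‖ := by
    rw [← Real.rpow_add_one hF.ne']; congr 1; ring
  -- Young's inequality, as the tangent bound at `‖f x‖ / ‖f‖`, scaled so that the two integrals add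
  -- up to `‖f‖ ^ (θ - 1)`.
  have hpt : ∀ x, ‖nonlinN θ (fun x => f x) x * (starRingEnd 𝕜) (b x)‖ ≤
      ‖f‖ ^ (θ - 1) / θ * ‖b x‖ ^ θ + (θ - 1) / (θ * ‖f‖) * ‖f x‖ ^ θ := by
    intro x
    rw [norm_mul, norm_nonlinN hθ, RCLike.norm_conj]
    rcases (norm_nonneg (f x)).eq_or_lt with h0 | h0
    · rw [← h0, Real.zero_rpow (by linarith), Real.zero_rpow hθ0.ne', zero_mul, mul_zero, add_zero]
      positivity
    · have ht := rpow_tangent_le (v := ‖b x‖) hθ.le (div_pos h0 hF)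
      have hfx : ‖f x‖ ^ θ = ‖f x‖ ^ (θ - 1) * ‖f x‖ := by
        rw [← Real.rpow_add_one h0.ne']; congr 1; ring
      rw [abs_norm, Real.div_rpow h0.le hF.le, Real.div_rpow h0.le hF.le, hfx, hFθ] at ht
      rw [hfx]
      have h2 := mul_le_mul_of_nonneg_left ht (show 0 ≤ ‖f‖ ^ (θ - 1) / θ by positivity)
      have h3 : ‖f‖ ^ (θ - 1) / θ * (‖f x‖ ^ (θ - 1) * ‖f x‖ / (‖f‖ ^ (θ - 1) * ‖f‖) +
          θ * (‖f x‖ ^ (θ - 1) / ‖f‖ ^ (θ - 1)) * (‖b x‖ - ‖f x‖ / ‖f‖)) =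
          ‖f x‖ ^ (θ - 1) * ‖b x‖ - (θ - 1) / (θ * ‖f‖) * (‖f x‖ ^ (θ - 1) * ‖f x‖) := by
        field_simp; ring
      linarith
  calc _ ≤ ∫ x, ‖nonlinN θ (fun x => f x) x * (starRingEnd 𝕜) (b x)‖ ∂μ :=
        norm_integral_le_integral_norm _
    _ ≤ ∫ x, (‖f‖ ^ (θ - 1) / θ * ‖b x‖ ^ θ + (θ - 1) / (θ * ‖f‖) * ‖f x‖ ^ θ) ∂μ :=
        integral_mono (integrable_nonlinN_mul hθ (Lp.memLp f) (memLp_div_norm e)).norm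
          ((hbi.const_mul _).add (hfi.const_mul _)) hpt
    _ = ‖f‖ ^ (θ - 1) := by
        rw [integral_add (hbi.const_mul _) (hfi.const_mul _), integral_const_mul,
          integral_const_mul, hb1, ← Lp_norm_rpow hθ, hFθ]
        field_simp; ring

end

/-! ### Admissible constants: existence of the largest, and the two inclusions. -/

section
variable {X : Type*} [MeasurableSpace X] {μ : Measure X} {𝕜 : Type*} [RCLike 𝕜] {θ r d : ℝ}

theorem zero_mem_admissibleConstants (hθ : 1 < θ) (hr : 0 < r) :
    (0 : ℝ) ∈ admissibleConstants 𝕜 μ θ r := by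
  have : Fact (1 ≤ ENNReal.ofReal θ) := ⟨by simpa using hθ.le⟩
  refine ⟨le_rfl, fun f e he => ?_⟩
  rw [zero_mul, add_zero]
  have h1 := Real.rpow_le_rpow (norm_nonneg _) (norm_sesqForm_le hθ f he)
    (show 0 ≤ r / (θ - 1) from div_nonneg hr.le (by linarith))
  rwa [← Real.rpow_mul (norm_nonneg _), mul_div_cancel₀ _ (by linarith)] at h1

theorem bddBelow_range_norm_rpow [Fact (1 ≤ ENNReal.ofReal θ)]
    (f e : Lp 𝕜 (ENNReal.ofReal θ) μ) :
    BddBelow (Set.range fun α : 𝕜 => ‖f - α • e‖ ^ r) :=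
  ⟨0, by rintro _ ⟨α, rfl⟩; positivity⟩

theorem Atomless.exists_measurableSet (hatom : Atomless μ) [SigmaFinite μ] (hμ : μ ≠ 0) :
    ∃ s t : Set X, MeasurableSet s ∧ MeasurableSet t ∧ Disjoint s t ∧
      0 < μ s ∧ μ s ≠ ∞ ∧ 0 < μ t ∧ μ t ≠ ∞ := by
  have huniv : 0 < μ Set.univ := pos_iff_ne_zero.2 (by simpa using hμ)
  obtain ⟨E, hE, -, hE0, hEfin⟩ := Measure.exists_subset_measure_lt_top .univ huniv
  obtain ⟨s, hsE, hs, hs0, hlt⟩ := hatom E hE hE0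
  have hsfin : μ s ≠ ∞ := measure_ne_top_of_subset hsE hEfin.ne
  refine ⟨s, E \ s, hs, hE.diff hs, Set.disjoint_sdiff_right, hs0, hsfin, ?_,
    measure_ne_top_of_subset Set.sdiff_subset hEfin.ne⟩
  rw [measure_sdiff hsE hs.nullMeasurableSet hsfin]
  exact tsub_pos_of_lt hlt

/-- Test on indicators of disjoint sets: subtracting multiples of `e` cannot reduce the norm of `f`.
-/
theorem admissibleConstants_le_one (hatom : Atomless μ) [SigmaFinite μ] (hμ : μ ≠ 0)
    (hθ : 1 < θ) (hr : 0 < r) (hd : d ∈ admissibleConstants 𝕜 μ θ r) : d ≤ 1 := by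
  have : Fact (1 ≤ ENNReal.ofReal θ) := ⟨by simpa using hθ.le⟩
  obtain ⟨s, t, hs, ht, hst, hs0, hsfin, ht0, htfin⟩ := hatom.exists_measurableSet hμ
  set f : Lp 𝕜 (ENNReal.ofReal θ) μ := indicatorConstLp _ hs hsfin 1 with hf
  set e : Lp 𝕜 (ENNReal.ofReal θ) μ := indicatorConstLp _ ht htfin 1 with he
  have hpos : ∀ {u : Set X} (hu : MeasurableSet u) (hufin : μ u ≠ ∞), 0 < μ u →
      0 < ‖(indicatorConstLp (ENNReal.ofReal θ) hu hufin 1 : Lp 𝕜 (ENNReal.ofReal θ) μ)‖ := by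
    intro u hu hufin hu0
    rw [norm_indicatorConstLp (ofReal_ne_zero_of_one_lt hθ) ENNReal.ofReal_ne_top, norm_one, one_mul]
    exact Real.rpow_pos_of_pos (ENNReal.toReal_pos hu0.ne' hufin) _
  have hfpos : 0 < ‖f‖ := hpos hs hsfin hs0
  have hepos : 0 < ‖e‖ := hpos ht htfin ht0
  have hle : ∀ α : 𝕜, ‖f‖ ≤ ‖f - α • e‖ := by
    intro α
    refine Lp.norm_le_norm_of_ae_le ?_
    filter_upwards [Lp.coeFn_sub f (α • e), Lp.coeFn_smul α e,
      indicatorConstLp_coeFn (p := ENNReal.ofReal θ) (hs := hs) (hμs := hsfin) (c := (1 : 𝕜)),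
      indicatorConstLp_coeFn (p := ENNReal.ofReal θ) (hs := ht) (hμs := htfin) (c := (1 : 𝕜))]
      with x h1 h2 h3 h4
    rw [h1, Pi.sub_apply, h2, Pi.smul_apply, h3, h4]
    by_cases hx : x ∈ s
    · simp [hx, hst.notMem_of_mem_left hx]
    · simp only [hx, not_false_eq_true, Set.indicator_of_notMem, norm_zero]
      exact norm_nonneg _
  have hinf : ‖f‖ ^ r ≤ ⨅ α : 𝕜, ‖f - α • e‖ ^ r :=
    le_ciInf fun α => Real.rpow_le_rpow hfpos.le (hle α) hr.le
  have h := hd.2 f e (norm_pos_iff.1 hepos)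
  have h1 := mul_le_mul_of_nonneg_left hinf hd.1
  have h2 : 0 ≤ ‖sesqForm 𝕜 μ (nonlinN θ (fun x => f x))
    (fun x => e x / ((‖e‖ : ℝ) : 𝕜))‖ ^ (r / (θ - 1)) := by positivity
  have h3 : 0 < ‖f‖ ^ r := Real.rpow_pos_of_pos hfpos _
  by_contra! hlt
  nlinarith

theorem isClosed_admissibleConstants : IsClosed (admissibleConstants 𝕜 μ θ r) := by
  have : admissibleConstants 𝕜 μ θ r = Set.Ici 0 ∩
      ⋂ (f : Lp 𝕜 (ENNReal.ofReal θ) μ) (e : Lp 𝕜 (ENNReal.ofReal θ) μ) (_ : e ≠ 0),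
        {d | ‖sesqForm 𝕜 μ (nonlinN θ (fun x => f x)) (fun x => e x / ((‖e‖ : ℝ) : 𝕜))‖
          ^ (r / (θ - 1)) + d * (⨅ α : 𝕜, ‖f - α • e‖ ^ r) ≤ ‖f‖ ^ r} := by
    ext d; simp [admissibleConstants, ImprovedHolder]
  rw [this]
  refine isClosed_Ici.inter (isClosed_iInter fun f => isClosed_iInter fun e =>
    isClosed_iInter fun _ => isClosed_le (by fun_prop) continuous_const)

theorem isGreatest_dStar (hatom : Atomless μ) [SigmaFinite μ] (hμ : μ ≠ 0)
    (hθ : 1 < θ) (hr : 0 < r) :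
    IsGreatest (admissibleConstants 𝕜 μ θ r) (dStar 𝕜 μ θ r) :=
  isClosed_admissibleConstants.isGreatest_csSup ⟨0, zero_mem_admissibleConstants hθ hr⟩
    ⟨1, fun _ hd => admissibleConstants_le_one hatom hμ hθ hr hd⟩

/-- Real functions are complex functions. -/
theorem admissibleConstants_complex_subset (hθ : 1 < θ) (hr : 0 < r) :
    admissibleConstants ℂ μ θ r ⊆ admissibleConstants ℝ μ θ r := by
  have : Fact (1 ≤ ENNReal.ofReal θ) := ⟨by simpa using hθ.le⟩
  rintro d ⟨hd, h⟩
  refine ⟨hd, fun f e he => ?_⟩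
  set F : Lp ℂ (ENNReal.ofReal θ) μ := Complex.ofRealCLM.compLp f with hF
  set G : Lp ℂ (ENNReal.ofReal θ) μ := Complex.ofRealCLM.compLp e with hG
  have hFx : ∀ᵐ x ∂μ, F x = (f x : ℂ) := Complex.ofRealCLM.coeFn_compLp f
  have hGx : ∀ᵐ x ∂μ, G x = (e x : ℂ) := Complex.ofRealCLM.coeFn_compLp e
  have hnF : ‖F‖ = ‖f‖ := by
    refine le_antisymm (Lp.norm_le_norm_of_ae_le ?_) (Lp.norm_le_norm_of_ae_le ?_) <;>
    · filter_upwards [hFx] with x hx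
      simp [hx]
  have hnG : ‖G‖ = ‖e‖ := by
    refine le_antisymm (Lp.norm_le_norm_of_ae_le ?_) (Lp.norm_le_norm_of_ae_le ?_) <;>
    · filter_upwards [hGx] with x hx
      simp [hx]
  have hG0 : G ≠ 0 := by rwa [← norm_ne_zero_iff, hnG, norm_ne_zero_iff]
  have hsesq : sesqForm ℂ μ (nonlinN θ (fun x => F x)) (fun x => G x / ((‖G‖ : ℝ) : ℂ)) =
      ((sesqForm ℝ μ (nonlinN θ (fun x => f x)) (fun x => e x / ((‖e‖ : ℝ) : ℝ)) : ℝ) : ℂ) := by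
    unfold sesqForm
    rw [← integral_complex_ofReal]
    refine integral_congr_ae ?_
    filter_upwards [hFx, hGx] with x h1 h2
    simp only [nonlinN_apply, h1, h2, hnG]
    simp
  -- For real `f` and `e`, replacing `α` by its real part can only decrease the norm.
  have hle : (⨅ α : ℝ, ‖f - α • e‖ ^ r) ≤ ⨅ α : ℂ, ‖F - α • G‖ ^ r := by
    refine le_ciInf fun α => (ciInf_le (bddBelow_range_norm_rpow f e) α.re).trans ?_
    refine Real.rpow_le_rpow (norm_nonneg _) (Lp.norm_le_norm_of_ae_le ?_) hr.le
    filter_upwards [hFx, hGx, Lp.coeFn_sub f (α.re • e), Lp.coeFn_smul α.re e,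
      Lp.coeFn_sub F (α • G), Lp.coeFn_smul α G] with x h1 h2 h3 h4 h5 h6
    rw [h3, h5, Pi.sub_apply, Pi.sub_apply, h4, h6, Pi.smul_apply, Pi.smul_apply, h1, h2]
    have := Complex.abs_re_le_norm ((f x : ℂ) - α • (e x : ℂ))
    simpa using this
  have hmain := h F G hG0
  rw [RCLike.ofReal_eq_complex_ofReal, hsesq, hnF] at hmain
  have h1 := mul_le_mul_of_nonneg_left hle hd
  simp only [Complex.norm_real] at hmain
  exact (add_le_add le_rfl h1).trans hmain

/-- The improved Hölder inequality for finitely supported laws. -/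
theorem lawRegion_subset_of_improvedHolder (hatom : Atomless μ) [SigmaFinite μ] (hμ : μ ≠ 0)
    (hθ : 1 < θ) (hr : 0 < r) (hd : 0 ≤ d) (h : ImprovedHolder ℝ μ θ r d) :
    lawRegion θ ⊆ {p : ℝ × ℝ × ℝ |
      max p.1 0 ^ (r / (θ - 1)) + d * max p.2.2 0 ^ (r / θ) ≤ max p.2.1 0 ^ (r / θ)} := by
  have : Fact (1 ≤ ENNReal.ofReal θ) := ⟨by simpa using hθ.le⟩
  have hθ0 : 0 < θ := by linarith
  have hθ1 : 0 < θ - 1 := by linarith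
  rintro ⟨A, B, m⟩ ⟨ν, hν, hA, hB, hm⟩
  simp only [Set.mem_ofPred_eq] at hA hB hm ⊢
  obtain ⟨s, -, hs, -, -, hs0, hsfin, -, -⟩ := hatom.exists_measurableSet hμ
  obtain ⟨G, hG, hreal⟩ := hatom.exists_realization hs hsfin hν
  set M := μ.real s with hM
  have hMpos : 0 < M := ENNReal.toReal_pos hs0.ne' hsfin
  set EN := Finsupp.linearCombination ℝ (fun x : ℝ => |x| ^ (θ - 2) * x) ν with hEN
  set Eθ := Finsupp.linearCombination ℝ (fun x : ℝ => |x| ^ θ) ν with hEθ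
  set e : Lp ℝ (ENNReal.ofReal θ) μ := indicatorConstLp _ hs hsfin 1 with he
  have hex : ∀ᵐ x ∂μ, e x = s.indicator (fun _ => (1 : ℝ)) x := indicatorConstLp_coeFn
  have hfmem : MemLp (s.indicator G) (ENNReal.ofReal θ) μ := by
    rw [memLp_indicator_iff_restrict hs,
      ← integrable_norm_rpow_iff hG.aestronglyMeasurable (ofReal_ne_zero_of_one_lt hθ)
        ENNReal.ofReal_ne_top, ENNReal.toReal_ofReal hθ0.le]
    exact (hreal (fun x => |x| ^ θ) (by fun_prop)).1
  set f : Lp ℝ (ENNReal.ofReal θ) μ := hfmem.toLp with hf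
  have hfx : ∀ᵐ x ∂μ, f x = s.indicator G x := hfmem.coeFn_toLp
  have hindic : ∀ φ : X → ℝ, ∀ ψ : ℝ → ℝ, Measurable ψ →
      (∀ᵐ x ∂μ, φ x = s.indicator (fun x => ψ (G x)) x) →
      ∫ x, φ x ∂μ = M * Finsupp.linearCombination ℝ ψ ν := by
    intro φ ψ hψ hφ
    rw [integral_congr_ae hφ, integral_indicator hs, (hreal ψ hψ).2]
  have hnorm_sub : ∀ α : ℝ, ‖f - α • e‖ ^ θ =
      M * Finsupp.linearCombination ℝ (fun x : ℝ => |x - α| ^ θ) ν := by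
    intro α
    rw [Lp_norm_rpow hθ]
    refine hindic _ _ (by fun_prop) ?_
    filter_upwards [hfx, hex, Lp.coeFn_sub f (α • e), Lp.coeFn_smul α e] with x h1 h2 h3 h4
    rw [h3, Pi.sub_apply, h4, Pi.smul_apply, h1, h2]
    by_cases hx : x ∈ s <;> simp [hx, Real.zero_rpow hθ0.ne']
  have hnorm_f : ‖f‖ ^ θ = M * Eθ := by simpa using hnorm_sub 0
  have hnorm_e : ‖e‖ = M ^ (1 / θ) := by
    rw [he, norm_indicatorConstLp (ofReal_ne_zero_of_one_lt hθ) ENNReal.ofReal_ne_top, norm_one, one_mul,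
      ENNReal.toReal_ofReal hθ0.le]
  have hepos : 0 < ‖e‖ := by rw [hnorm_e]; positivity
  have hsesq : sesqForm ℝ μ (nonlinN θ (fun x => f x)) (fun x => e x / ((‖e‖ : ℝ) : ℝ)) =
      M * EN / ‖e‖ := by
    have : sesqForm ℝ μ (nonlinN θ (fun x => f x)) (fun x => e x / ((‖e‖ : ℝ) : ℝ)) =
        (∫ x, nonlinN θ (fun x => f x) x * e x ∂μ) / ‖e‖ := by
      rw [← integral_div]
      refine integral_congr_ae (Filter.Eventually.of_forall fun x => ?_)
      simp [mul_div_assoc]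
    rw [this]
    congr 1
    refine hindic _ _ (by fun_prop) ?_
    filter_upwards [hfx, hex] with x h1 h2
    rw [nonlinN_apply, h1, h2]
    by_cases hx : x ∈ s <;> simp [hx]
  have hrpow : ∀ g : Lp ℝ (ENNReal.ofReal θ) μ, ‖g‖ ^ r = (‖g‖ ^ θ) ^ (r / θ) := fun g => by
    rw [← Real.rpow_mul (norm_nonneg _), mul_div_cancel₀ _ hθ0.ne']
  have hrθ : 0 ≤ r / θ := by positivity
  have hEθ0 : 0 ≤ Eθ := by
    have : 0 ≤ M * Eθ := hnorm_f ▸ (by positivity)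
    exact nonneg_of_mul_nonneg_right this hMpos
  have hMr : 0 < M ^ (r / θ) := by positivity
  have hinf : M ^ (r / θ) * max m 0 ^ (r / θ) ≤ ⨅ α : ℝ, ‖f - α • e‖ ^ r := by
    refine le_ciInf fun α => ?_
    rw [← Real.mul_rpow hMpos.le (le_max_right _ _), hrpow]
    refine Real.rpow_le_rpow (by positivity) ?_ hrθ
    have h0 : 0 ≤ ‖f - α • e‖ ^ θ := by positivity
    rw [hnorm_sub] at h0 ⊢
    exact mul_le_mul_of_nonneg_left
      (max_le (hm α) (nonneg_of_mul_nonneg_right h0 hMpos)) hMpos.le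
  -- As `‖e‖ = M ^ (1 / θ)`, the pairing scales like `M ^ ((θ - 1) / θ)`; hence all three terms
  -- carry the factor `M ^ (r / θ)`.
  have hA' : M ^ (r / θ) * max A 0 ^ (r / (θ - 1)) ≤ ‖M * EN / ‖e‖‖ ^ (r / (θ - 1)) := by
    have h1 : M ^ (r / θ) = (M / M ^ (1 / θ)) ^ (r / (θ - 1)) := by
      nth_rw 2 [← Real.rpow_one M]
      rw [← Real.rpow_sub hMpos, ← Real.rpow_mul hMpos.le]
      congr 1; field_simp
    rw [h1, ← Real.mul_rpow (by positivity) (le_max_right _ _)]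
    refine Real.rpow_le_rpow (by positivity) ?_ (by positivity)
    rw [norm_div, norm_mul, norm_norm, hnorm_e, Real.norm_of_nonneg hMpos.le, mul_div_right_comm]
    gcongr
    exact max_le (hA.trans (le_abs_self _)) (norm_nonneg _)
  have hmain := h f e (norm_pos_iff.1 hepos)
  rw [RCLike.ofReal_real_eq_id, id, hsesq, hrpow f, hnorm_f, Real.mul_rpow hMpos.le hEθ0] at hmain
  have h1 := mul_le_mul_of_nonneg_left hinf hd
  have h2 : Eθ ^ (r / θ) ≤ max B 0 ^ (r / θ) :=
    Real.rpow_le_rpow hEθ0 (hB.trans (le_max_left _ _)) hrθ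
  refine le_trans (le_of_mul_le_mul_left ?_ hMr) h2
  linarith

/-- The pointwise Lagrangian bound transported to a pair of values of `f` and of the normalized
`e`. -/
theorem lagrangian_le_pair {l κ w α s : ℝ} (hθ : 1 < θ) (hwκ : w ≤ κ)
    (h : ∀ z : ℂ, w * ‖z - α‖ ^ θ + l * (‖z‖ ^ (θ - 2) * z.re) - κ * ‖z‖ ^ θ ≤ s)
    {c : ℂ} (hc : ‖c‖ = 1) (a b : ℂ) :
    w * ‖a - (α * c⁻¹) * b‖ ^ θ
      + l * (c * ((‖a‖ ^ (θ - 2) : ℝ) * a * (starRingEnd ℂ) b)).re - κ * ‖a‖ ^ θ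
      ≤ s * ‖b‖ ^ θ := by
  have hθ0 : 0 < θ := by linarith
  have hc0 : c ≠ 0 := by rw [← norm_ne_zero_iff, hc]; exact one_ne_zero
  -- Where `e` vanishes the quotient is unavailable, and the claim is `(w - κ) ‖a‖ ^ θ ≤ 0`; this is
  -- where `w ≤ κ` enters.
  rcases eq_or_ne b 0 with rfl | hb
  · have h1 : 0 ≤ ‖a‖ ^ θ := by positivity
    simp [Real.zero_rpow hθ0.ne']
    nlinarith
  have hb0 : 0 < ‖b‖ := norm_pos_iff.2 hb
  have hbθ : 0 < ‖b‖ ^ θ := by positivity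
  have hz := mul_le_mul_of_nonneg_right (h (c * a / b)) hbθ.le
  have h1 : ‖a - (α * c⁻¹) * b‖ ^ θ = ‖c * a / b - α‖ ^ θ * ‖b‖ ^ θ := by
    rw [← Real.mul_rpow (norm_nonneg _) hb0.le, ← norm_mul]
    congr 1
    rw [← one_mul ‖a - _‖, ← hc, ← norm_mul]
    congr 1; field_simp
  have hn : ‖c * a / b‖ = ‖a‖ / ‖b‖ := by rw [norm_div, norm_mul, hc, one_mul]
  have h2 : ‖a‖ ^ θ = ‖c * a / b‖ ^ θ * ‖b‖ ^ θ := by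
    rw [← Real.mul_rpow (norm_nonneg _) hb0.le, hn]
    congr 1; field_simp
  have h3 : (c * ((‖a‖ ^ (θ - 2) : ℝ) * a * (starRingEnd ℂ) b)).re =
      ‖c * a / b‖ ^ (θ - 2) * (c * a / b).re * ‖b‖ ^ θ := by
    have e1 : c * ((‖a‖ ^ (θ - 2) : ℝ) * a * (starRingEnd ℂ) b) =
        ((‖a‖ ^ (θ - 2) * ‖b‖ ^ 2 : ℝ) : ℂ) * (c * a / b) := by
      have : (starRingEnd ℂ) b = ((‖b‖ ^ 2 : ℝ) : ℂ) / b := by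
        rw [eq_div_iff hb, mul_comm, Complex.mul_conj, Complex.normSq_eq_norm_sq]
      rw [this]; push_cast; field_simp
    rw [e1, Complex.re_ofReal_mul, hn, Real.div_rpow (norm_nonneg _) hb0.le]
    have e2 : ‖b‖ ^ θ = ‖b‖ ^ (θ - 2) * ‖b‖ ^ 2 := by
      rw [← Real.rpow_natCast, ← Real.rpow_add hb0]; congr 1; push_cast; ring
    rw [e2]
    have : ‖b‖ ^ (θ - 2) ≠ 0 := by positivity
    field_simp
  rw [h1, h3, h2]
  linarith

/-- Integrating the pointwise complex bound avoids discretizing the law of `c f / b` and needs no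
separate treatment of the zeros of `e`. -/
theorem mem_closure_lawRegion_of_Lp (hθ : 1 < θ) [Fact (1 ≤ ENNReal.ofReal θ)]
    (f : Lp ℂ (ENNReal.ofReal θ) μ) {e : Lp ℂ (ENNReal.ofReal θ) μ} (he : e ≠ 0) {m : ℝ}
    (hm : ∀ α : ℂ, m ≤ ‖f - α • e‖ ^ θ) :
    (‖sesqForm ℂ μ (nonlinN θ (fun x => f x)) (fun x => e x / ((‖e‖ : ℝ) : ℂ))‖, ‖f‖ ^ θ, m)
      ∈ closure (lawRegion θ) := by
  refine mem_closure_lawRegion hθ fun l κ w α s hl hw hwκ h => ?_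
  have hb := memLp_div_norm e
  set b : X → ℂ := fun x => e x / ((‖e‖ : ℝ) : ℂ) with hbdef
  set S := sesqForm ℂ μ (nonlinN θ (fun x => f x)) b with hS
  obtain ⟨c, hc, hcS⟩ : ∃ c : ℂ, ‖c‖ = 1 ∧ c * S = ‖S‖ := by
    rcases eq_or_ne S 0 with h0 | h0
    · exact ⟨1, by simp, by simp [h0]⟩
    · have hn : ‖S‖ ≠ 0 := norm_ne_zero_iff.2 h0
      refine ⟨‖S‖ / S, by simp [hn], div_mul_cancel₀ _ h0⟩
  have hint := integrable_nonlinN_mul hθ (Lp.memLp f) hb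
  have hfi := (Lp.memLp f).integrable_norm_rpow_ofReal hθ
  have hbi := hb.integrable_norm_rpow_ofReal hθ
  have hb1 : ∫ x, ‖b x‖ ^ θ ∂μ = 1 := integral_div_norm_rpow hθ he
  set g : Lp ℂ (ENNReal.ofReal θ) μ := f - (α * c⁻¹ / (‖e‖ : ℝ) : ℂ) • e with hg
  have hgi := (Lp.memLp g).integrable_norm_rpow_ofReal hθ
  have hgx : ∀ᵐ x ∂μ, g x = f x - (α * c⁻¹) * b x := by
    filter_upwards [Lp.coeFn_sub f ((α * c⁻¹ / (‖e‖ : ℝ) : ℂ) • e),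
      Lp.coeFn_smul (α * c⁻¹ / (‖e‖ : ℝ) : ℂ) e] with x h1 h2
    rw [hg, h1, Pi.sub_apply, h2, Pi.smul_apply, smul_eq_mul, hbdef]
    simp only
    congr 1
    ring
  have hint' : Integrable
      (fun x => (c * (nonlinN θ (fun x => f x) x * (starRingEnd ℂ) (b x))).re) μ :=
    (hint.const_mul c).re
  have hsum := (hgi.const_mul w).add (hint'.const_mul l)
  have hre : ∫ x, (c * (nonlinN θ (fun x => f x) x * (starRingEnd ℂ) (b x))).re ∂μ = ‖S‖ := by
    have h1 := integral_re (hint.const_mul c)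
    rw [integral_const_mul] at h1
    refine h1.trans ?_
    change (c * S).re = ‖S‖
    rw [hcS, Complex.ofReal_re]
  have hmono : ∫ x, (w * ‖g x‖ ^ θ
      + l * (c * (nonlinN θ (fun x => f x) x * (starRingEnd ℂ) (b x))).re - κ * ‖f x‖ ^ θ) ∂μ
      ≤ ∫ x, s * ‖b x‖ ^ θ ∂μ := by
    refine integral_mono_ae (hsum.sub (hfi.const_mul κ))
      (hbi.const_mul s) ?_
    filter_upwards [hgx] with x hx
    rw [hx, nonlinN_apply]
    exact lagrangian_le_pair hθ hwκ h hc (f x) (b x)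
  rw [integral_sub (by exact hsum) (hfi.const_mul κ),
    integral_add (hgi.const_mul w) (hint'.const_mul l), integral_const_mul, integral_const_mul,
    integral_const_mul, integral_const_mul, hb1, hre,
    ← Lp_norm_rpow hθ, ← Lp_norm_rpow hθ] at hmono
  have := mul_le_mul_of_nonneg_left (hm (α * c⁻¹ / (‖e‖ : ℝ) : ℂ)) hw
  linarith

theorem admissibleConstants_real_subset (hatom : Atomless μ) [SigmaFinite μ] (hμ : μ ≠ 0)
    (hθ : 1 < θ) (hr : 0 < r) :
    admissibleConstants ℝ μ θ r ⊆ admissibleConstants ℂ μ θ r := by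
  have : Fact (1 ≤ ENNReal.ofReal θ) := ⟨by simpa using hθ.le⟩
  have hθ0 : 0 < θ := by linarith
  have hθ1 : 0 < θ - 1 := by linarith
  rintro d ⟨hd, h⟩
  refine ⟨hd, fun f e he => ?_⟩
  set I := ⨅ α : ℂ, ‖f - α • e‖ ^ r with hI
  have hI0 : 0 ≤ I := le_ciInf fun α => by positivity
  -- The exponent `θ / r` turns the infimum of `r`-th powers into a lower bound for `θ`-th powers.
  have hmem := mem_closure_lawRegion_of_Lp hθ f he (m := I ^ (θ / r)) fun α => by
    have h1 : I ≤ ‖f - α • e‖ ^ r := ciInf_le (bddBelow_range_norm_rpow f e) α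
    have h2 := Real.rpow_le_rpow hI0 h1 (show 0 ≤ θ / r by positivity)
    rwa [← Real.rpow_mul (norm_nonneg _), mul_div_cancel₀ _ hr.ne'] at h2
  have hclosed : IsClosed {p : ℝ × ℝ × ℝ |
      max p.1 0 ^ (r / (θ - 1)) + d * max p.2.2 0 ^ (r / θ) ≤ max p.2.1 0 ^ (r / θ)} := by
    have h1 : 0 ≤ r / (θ - 1) := by positivity
    have h2 : 0 ≤ r / θ := by positivity
    refine isClosed_le (.add (.rpow_const (by fun_prop) fun _ => Or.inr h1)
      (.mul continuous_const (.rpow_const (by fun_prop) fun _ => Or.inr h2)))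
      (.rpow_const (by fun_prop) fun _ => Or.inr h2)
  have hfin := closure_minimal (lawRegion_subset_of_improvedHolder hatom hμ hθ hr hd h)
    hclosed hmem
  simp only [Set.mem_ofPred_eq] at hfin
  rw [max_eq_left (norm_nonneg _), max_eq_left (by positivity), max_eq_left (by positivity),
    ← Real.rpow_mul hI0, ← Real.rpow_mul (norm_nonneg _), mul_div_cancel₀ _ hθ0.ne',
    show θ / r * (r / θ) = 1 by field_simp, Real.rpow_one] at hfin
  exact hfin

end

theorem proposition1p17 {X : Type*} [MeasurableSpace X] (μ : Measure X) [SigmaFinite μ]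
    (hμ : μ ≠ 0) (hatom : Atomless μ) (θ : ℝ) (hθ : 1 < θ) (r : ℝ) (hr : 0 < r) :
    IsGreatest (admissibleConstants ℝ μ θ r) (dStar ℝ μ θ r) ∧
    IsGreatest (admissibleConstants ℂ μ θ r) (dStar ℂ μ θ r) ∧
    dStar ℝ μ θ r = dStar ℂ μ θ r := by
  refine ⟨isGreatest_dStar hatom hμ hθ hr, isGreatest_dStar hatom hμ hθ hr, ?_⟩
  unfold dStar
  rw [(admissibleConstants_real_subset hatom hμ hθ hr).antisymm
    (admissibleConstants_complex_subset hθ hr)]
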